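/- Let $G$ be a finite, nonempty simple graph. Write $\lambda_2(G)$ for the second largest eigenvalue, counted with multiplicity, of the adjacency matrix of $G$, and $\kappa'(G)$ for the edge-connectivity of $G$, that is, the largest integer $k$ such that for every set $S$ of fewer than $k$ edges of $G$ the graph $G-S$ is connected. Let $d$ and $t$ be positive integers with $3 \le t \le d-1$, and suppose that $G$ is $d$-regular. 1. If $$\lambda_2(G) < \frac{d-3+\sqrt{(d+3)^2-8t}}{2},$$ then $\kappa'(G) \ge t+1$. 2. If $t$ is odd and $$\lambda_2(G) < \frac{d-4+\sqrt{(d+4)^2-8t}}{2},$$ then $\kappa'(G) \ge t+1$. -/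

import Mathlib

namespace SimpleGraph

/-- The edge-connectivity `κ'(G)`: the largest `k` such that `G` is `k`-edge-connected, i.e. such
that deleting fewer than `k` edges never disconnects `G`. It takes values in `ℕ∞`; it is finite as
soon as `G` is finite with at least two vertices. -/
noncomputable def edgeConnectivity {V : Type*} (G : SimpleGraph V) : ℕ∞ :=
  sSup {m : ℕ∞ | ∃ k : ℕ, m = k ∧ G.IsEdgeConnected k}

/-- The second largest eigenvalue `λ₂(G)` (with multiplicity) of the adjacency matrix of a finite
graph with at least two vertices. Mathlib's `eigenvalues₀` lists the eigenvalues, with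
multiplicity, in non-increasing order, starting at index `0`. -/
noncomputable def secondEigenvalue {V : Type*} [Fintype V] [DecidableEq V] [Nontrivial V]
    (G : SimpleGraph V) [DecidableRel G.Adj] : ℝ :=
  (G.isHermitian_adjMatrix (R := ℝ)).eigenvalues₀ ⟨1, Fintype.one_lt_card⟩

end SimpleGraph

/-! Argue by contraposition. A cut of at most `t < d` edges leaves at least `d + 1` vertices on each
side, because a smaller set in a `d`-regular graph sends out at least `d` edges. Such a cut yields a
test function `f`, orthogonal to constants: a positive constant on one side and a negative constant
on the other, each shrunk by a factor `1 - δ / T` at the endpoints of cut edges. This softens the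
jump across the cut at the price of some energy inside each side. When `δ * (N + 2 - δ) ≥ 2 * T`,
with `N` a lower bound for the side sizes and `T` one above for the cut, the energy of `f` gives `λ₂
≥ d - δ` (`le_secondEigenvalue_of_cut`). For `N = d + 1`, `T = t` and equality, `d - δ` is the first
threshold. For odd `t`, parity excludes sides of `d + 1` vertices when the cut has exactly `t`
edges, so `N = d + 2`; a smaller cut is handled with `T = t - 1`. -/

/-! ### Variational lower bounds for the second eigenvalue. -/

open scoped Matrix in
/-- The lower half of the Courant-Fischer theorem for the second largest eigenvalue. -/
theorem Matrix.IsHermitian.le_eigenvalues₀_one {n : Type*} [Fintype n] [DecidableEq n]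
    {A : Matrix n n ℝ} (hA : A.IsHermitian) (hn : 1 < Fintype.card n) {x y : n → ℝ} {μ : ℝ}
    (hxy : LinearIndependent ℝ ![x, y])
    (h : ∀ a b : ℝ, μ * ((a • x + b • y) ⬝ᵥ (a • x + b • y)) ≤
      (a • x + b • y) ⬝ᵥ A *ᵥ (a • x + b • y)) :
    μ ≤ hA.eigenvalues₀ ⟨1, hn⟩ := by
  set e : Fin (Fintype.card n) ≃ n := Fintype.equivOfCardEq (Fintype.card_fin _) with he
  set v := hA.eigenvectorBasis with hv
  set j₀ : n := e ⟨0, by omega⟩ with hj₀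
  obtain ⟨z, hz0, hzv, hz⟩ : ∃ z : n → ℝ, z ≠ 0 ∧ ⇑(v j₀) ⬝ᵥ z = 0 ∧
      μ * (z ⬝ᵥ z) ≤ z ⬝ᵥ A *ᵥ z := by
    rw [LinearIndependent.pair_iff] at hxy
    by_cases hx : ⇑(v j₀) ⬝ᵥ x = 0
    · refine ⟨x, ?_, hx, by simpa using h 1 0⟩
      rintro rfl
      simpa using hxy 1 0
    -- The plane spanned by `x` and `y` meets the hyperplane orthogonal to the top eigenvector `v
    -- j₀`.
    · refine ⟨(⇑(v j₀) ⬝ᵥ y) • x + (-(⇑(v j₀) ⬝ᵥ x)) • y, fun h0 => hx ?_, ?_, h _ _⟩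
      · simpa using (hxy _ _ h0).2
      · simp only [dotProduct_add, dotProduct_smul, smul_eq_mul]
        ring
  have hinner (i : n) (w : n → ℝ) : inner ℝ (v i) (WithLp.toLp 2 w) = ⇑(v i) ⬝ᵥ w := by
    rw [EuclideanSpace.inner_eq_star_dotProduct, dotProduct_comm]
    simp
  have hinner' (i : n) (w : n → ℝ) : inner ℝ (WithLp.toLp 2 w) (v i) = ⇑(v i) ⬝ᵥ w := by
    rw [real_inner_comm, hinner]
  have hparseval (w : n → ℝ) : z ⬝ᵥ w = ∑ i, (⇑(v i) ⬝ᵥ z) * (⇑(v i) ⬝ᵥ w) := by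
    have := v.sum_inner_mul_inner (WithLp.toLp 2 z) (WithLp.toLp 2 w)
    rw [EuclideanSpace.inner_eq_star_dotProduct] at this
    simp only [hinner, hinner'] at this
    rw [dotProduct_comm]
    simpa using this.symm
  have hvA (i : n) : ⇑(v i) ⬝ᵥ A *ᵥ z = hA.eigenvalues i * (⇑(v i) ⬝ᵥ z) := by
    have hAt : Aᵀ = A := by simpa [IsHermitian] using hA
    rw [dotProduct_mulVec, ← mulVec_transpose, hAt, hv, hA.mulVec_eigenvectorBasis,
      smul_dotProduct, smul_eq_mul]
  by_contra! hlt
  have hlam (i : n) (hi : i ≠ j₀) : hA.eigenvalues i < μ := by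
    refine lt_of_le_of_lt (hA.eigenvalues₀_antitone ?_) hlt
    rw [Fin.le_def]
    have : e.symm i ≠ ⟨0, by omega⟩ := fun hc => hi (by rw [hj₀, ← hc, e.apply_symm_apply])
    rw [Ne, Fin.ext_iff] at this
    change 1 ≤ (e.symm i : ℕ)
    simp only at this
    omega
  -- The `j₀` term vanishes and every other coefficient is positive, so `z` has no component in the
  -- eigenbasis.
  have hsum : ∑ i, (μ - hA.eigenvalues i) * (⇑(v i) ⬝ᵥ z) ^ 2 ≤ 0 := by
    rw [hparseval, hparseval] at hz
    simp only [hvA] at hz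
    rw [Finset.mul_sum, ← sub_nonpos, ← Finset.sum_sub_distrib] at hz
    refine le_of_eq_of_le (Finset.sum_congr rfl fun i _ => ?_) hz
    ring
  have hnonneg (i : n) : 0 ≤ (μ - hA.eigenvalues i) * (⇑(v i) ⬝ᵥ z) ^ 2 := by
    by_cases hi : i = j₀
    · simp [hi, hzv]
    · exact mul_nonneg (sub_nonneg.2 (hlam i hi).le) (sq_nonneg _)
  have hall (i : n) : ⇑(v i) ⬝ᵥ z = 0 := by
    by_cases hi : i = j₀
    · rw [hi, hzv]
    · have h0 := (Finset.sum_eq_zero_iff_of_nonneg fun i _ => hnonneg i).1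
        (le_antisymm hsum (Finset.sum_nonneg fun i _ => hnonneg i)) i (Finset.mem_univ i)
      simpa [(sub_pos.2 (hlam i hi)).ne'] using h0
  have := hparseval z
  simp only [hall, mul_zero, Finset.sum_const_zero] at this
  exact hz0 (dotProduct_self_eq_zero.1 this)

namespace SimpleGraph

variable {V : Type*} [Fintype V] [DecidableEq V]

open scoped Matrix in
theorem IsRegularOfDegree.dotProduct_adjMatrix_mulVec {G : SimpleGraph V} [DecidableRel G.Adj]
    {d : ℕ} (hG : G.IsRegularOfDegree d) (f : V → ℝ) :
    f ⬝ᵥ G.adjMatrix ℝ *ᵥ f =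
      d * (f ⬝ᵥ f) - (∑ i, ∑ j, if G.Adj i j then (f i - f j) ^ 2 else 0) / 2 := by
  rw [← G.lapMatrix_toLinearMap₂' (R := ℝ) f, Matrix.toLinearMap₂'_apply', lapMatrix,
    Matrix.sub_mulVec, dotProduct_sub]
  have : G.degMatrix ℝ *ᵥ f = (d : ℝ) • f := by
    ext i
    simp [degMatrix, Matrix.mulVec_diagonal, hG.degree_eq i]
  rw [this, dotProduct_smul, smul_eq_mul]
  ring

/-- A variational lower bound for the second eigenvalue of a regular graph. -/
theorem IsRegularOfDegree.le_secondEigenvalue [Nontrivial V] {G : SimpleGraph V}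
    [DecidableRel G.Adj] {d : ℕ} (hG : G.IsRegularOfDegree d) {f : V → ℝ} {δ : ℝ} (hδ : 0 ≤ δ)
    (hf : f ≠ 0) (hsum : ∑ v, f v = 0)
    (h : (∑ i, ∑ j, if G.Adj i j then (f i - f j) ^ 2 else 0) ≤ 2 * δ * ∑ v, f v ^ 2) :
    d - δ ≤ G.secondEigenvalue := by
  have hdot : f ⬝ᵥ f = ∑ v, f v ^ 2 := by simp [dotProduct, sq]
  have h1f : (1 : V → ℝ) ⬝ᵥ f = 0 := by simpa [dotProduct] using hsum
  have h11 : 0 < (1 : V → ℝ) ⬝ᵥ 1 := by simp [dotProduct, Fintype.card_pos]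
  refine Matrix.IsHermitian.le_eigenvalues₀_one _ _ (x := 1) (y := f) ?_ fun a b => ?_
  · rw [LinearIndependent.pair_iff]
    intro s t hst
    have hs := congrArg ((1 : V → ℝ) ⬝ᵥ ·) hst
    simp only [dotProduct_add, dotProduct_smul, h1f, mul_zero, add_zero, dotProduct_zero,
      smul_eq_mul, mul_eq_zero, h11.ne', or_false] at hs
    subst hs
    simpa [hf] using hst
  · rw [hG.dotProduct_adjMatrix_mulVec]
    -- Constants carry no energy, so only the `f` component contributes.
    have hE : (∑ i, ∑ j, if G.Adj i j then
        ((a • 1 + b • f) i - (a • 1 + b • f) j) ^ 2 else 0) =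
        b ^ 2 * ∑ i, ∑ j, if G.Adj i j then (f i - f j) ^ 2 else 0 := by
      simp only [Finset.mul_sum, mul_ite, mul_zero]
      refine Finset.sum_congr rfl fun i _ => Finset.sum_congr rfl fun j _ => ?_
      congr 1
      simp
      ring
    have hN : (a • 1 + b • f) ⬝ᵥ (a • 1 + b • f) =
        a ^ 2 * ((1 : V → ℝ) ⬝ᵥ 1) + b ^ 2 * ∑ v, f v ^ 2 := by
      simp only [dotProduct_add, add_dotProduct, dotProduct_smul, smul_dotProduct, h1f,
        dotProduct_comm f 1, hdot, smul_eq_mul]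
      ring
    rw [hE, hN]
    have h1 := mul_le_mul_of_nonneg_left h (sq_nonneg b)
    have h2 := mul_nonneg hδ (mul_nonneg (sq_nonneg a) h11.le)
    linarith

end SimpleGraph

/-! ### Test function supported by an edge cut. -/

/-- The energy estimate on one side of an edge cut: `n` vertices, `b` of them on the boundary, and
at most `T` crossing edges. -/
theorem cut_side_energy_le {N T δ n b : ℝ} (hδ : 0 < δ) (hδ2 : δ ≤ 2) (hT : 2 ≤ T) (hN2 : 2 ≤ N)
    (hN : 2 * T ≤ δ * (N + 2 - δ)) (hn : N ≤ n) (hb : b ≤ T) :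
    2 * T * (1 - δ / T) ^ 2 + (δ / T) ^ 2 * (b * (n - b)) ≤
      δ * (n - b + b * (1 - δ / T) ^ 2) := by
  have hT0 : 0 < T := by linarith
  obtain ⟨c, rfl⟩ : ∃ c, δ = c * T := ⟨δ / T, by field_simp⟩
  have hc : 0 < c := pos_of_mul_pos_left hδ hT0.le
  have hc1 : c ≤ 1 := le_of_mul_le_mul_right (by linarith) hT0
  rw [mul_div_assoc, div_self hT0.ne', mul_one, ← sub_nonneg]
  -- Every term of the slack is nonnegative; all vanish at `b = T`, `n = N` with equality in `hN`.
  have key : c * T * (n - b + b * (1 - c) ^ 2) - (2 * T * (1 - c) ^ 2 + c ^ 2 * (b * (n - b))) =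
      (1 - c) * (c * T * (N + 2 - c * T) - 2 * T) + c * (n - N) * (T * (1 - c)) +
        c ^ 2 * (T - b) * (n - c * T) + c ^ 2 * (T - b) ^ 2 := by
    ring
  rw [key]
  have h1 : 0 ≤ 1 - c := by linarith
  have h2 : 0 ≤ c * T * (N + 2 - c * T) - 2 * T := by linarith
  have h3 : 0 ≤ n - N := by linarith
  have h4 : 0 ≤ T - b := by linarith
  have h5 : 0 ≤ n - c * T := by linarith
  positivity

namespace SimpleGraph

open Finset

theorem card_interedges_eq_sum {V : Type*} (G : SimpleGraph V) [DecidableRel G.Adj] (S T : Finset V) :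
    #(G.interedges S T) = ∑ v ∈ S, #(T.filter (G.Adj v)) := by
  rw [interedges, Rel.interedges, card_filter, sum_product]
  simp only [card_filter]

theorem card_interedges_self_le {V : Type*} [DecidableEq V] (G : SimpleGraph V) [DecidableRel G.Adj]
    (S : Finset V) : #(G.interedges S S) ≤ #S * (#S - 1) := by
  rw [card_interedges_eq_sum, ← smul_eq_mul]
  refine sum_le_card_nsmul _ _ _ fun v hv => ?_
  rw [← card_erase_of_mem hv]
  refine card_le_card fun w hw => ?_
  rw [mem_filter] at hw
  exact mem_erase.2 ⟨hw.2.ne', hw.1⟩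

/-- Swapping is a fixed-point-free involution on the ordered pairs, so each inner edge counts twice.
-/
theorem even_card_interedges_self {V : Type*} (G : SimpleGraph V) [DecidableRel G.Adj]
    (S : Finset V) : Even #(G.interedges S S) := by
  rw [← ZMod.natCast_eq_zero_iff_even, ← mul_one (#(G.interedges S S) : ZMod 2), ← nsmul_eq_mul,
    ← sum_const]
  refine sum_involution (fun p _ => p.swap) (fun _ _ => by decide) (fun p hp _ h => ?_)
    (fun p hp => ?_) (fun p _ => p.swap_swap)
  · obtain ⟨-, -, hp⟩ := G.mem_interedges_iff.1 hp
    exact hp.ne' (congrArg Prod.fst h)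
  · obtain ⟨h1, h2, h3⟩ := G.mem_interedges_iff.1 hp
    exact G.mem_interedges_iff.2 ⟨h2, h1, h3.symm⟩

variable {V : Type*} [Fintype V] [DecidableEq V] {G : SimpleGraph V} [DecidableRel G.Adj]

/-- A small edge cut with large sides forces a large second eigenvalue. -/
theorem IsRegularOfDegree.le_secondEigenvalue_of_cut [Nontrivial V] {d : ℕ}
    (hG : G.IsRegularOfDegree d) (S : Finset V) {N T : ℕ} {δ : ℝ} (hδ : 0 < δ) (hδ2 : δ ≤ 2)
    (hT : 2 ≤ T) (hN3 : 3 ≤ N) (hN : 2 * (T : ℝ) ≤ δ * (N + 2 - δ)) (hS : N ≤ #S)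
    (hS' : N ≤ #Sᶜ) (hcut : #(G.interedges S Sᶜ) ≤ T) :
    d - δ ≤ G.secondEigenvalue := by
  classical
  obtain ⟨B, hBS, hBT, hB⟩ : ∃ B ⊆ S, #B ≤ T ∧ ∀ v ∈ S, ∀ w ∈ Sᶜ, G.Adj v w → v ∈ B := by
    refine ⟨(G.interedges S Sᶜ).image Prod.fst, fun v hv => ?_, card_image_le.trans hcut,
      fun v hv w hw hvw => mem_image.2 ⟨(v, w), G.mem_interedges_iff.2 ⟨hv, hw, hvw⟩, rfl⟩⟩
    obtain ⟨p, hp, rfl⟩ := mem_image.1 hv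
    exact (G.mem_interedges_iff.1 hp).1
  obtain ⟨B', hBS', hBT', hB'⟩ : ∃ B ⊆ Sᶜ, #B ≤ T ∧ ∀ v ∈ S, ∀ w ∈ Sᶜ, G.Adj v w → w ∈ B := by
    refine ⟨(G.interedges S Sᶜ).image Prod.snd, fun v hv => ?_, card_image_le.trans hcut,
      fun v hv w hw hvw => mem_image.2 ⟨(v, w), G.mem_interedges_iff.2 ⟨hv, hw, hvw⟩, rfl⟩⟩
    obtain ⟨p, hp, rfl⟩ := mem_image.1 hv
    exact (G.mem_interedges_iff.1 hp).2.1
  set c : ℝ := δ / T with hc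
  have hT2 : (2 : ℝ) ≤ T := by exact_mod_cast hT
  have hc0 : 0 < c := by positivity
  have hc1 : c ≤ 1 := (div_le_one (by positivity)).2 (by linarith)
  have hside {n b : ℕ} (hn : N ≤ n) (hb : b ≤ T) :
      2 * (T : ℝ) * (1 - c) ^ 2 + c ^ 2 * (b * (n - b)) ≤ δ * (n - b + b * (1 - c) ^ 2) :=
    cut_side_energy_le hδ hδ2 hT2 (by exact_mod_cast (by omega : 2 ≤ N)) hN (by exact_mod_cast hn) (by exact_mod_cast hb)
  set g : Finset V → V → ℝ := fun C v => if v ∈ C then 1 - c else 1 with hg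
  have hgsum (S C : Finset V) (hC : C ⊆ S) : ∑ v ∈ S, g C v = #S - c * #C := by
    have : ∀ v, g C v = 1 - if v ∈ C then c else 0 := fun v => by simp only [hg]; split_ifs <;> ring
    simp only [this, sum_sub_distrib, sum_ite_mem, inter_eq_right.2 hC]
    simp [mul_comm]
  have hgsq (S C : Finset V) (hC : C ⊆ S) :
      ∑ v ∈ S, g C v ^ 2 = #S - #C + #C * (1 - c) ^ 2 := by
    have : ∀ v, g C v ^ 2 = 1 - if v ∈ C then 1 - (1 - c) ^ 2 else 0 := fun v => by
      simp only [hg]; split_ifs <;> ring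
    simp only [this, sum_sub_distrib, sum_ite_mem, inter_eq_right.2 hC]
    simp
    ring
  have hgpos (S C : Finset V) (hS : N ≤ #S) (hC : C ⊆ S) (hCT : #C ≤ T) :
      0 < ∑ v ∈ S, g C v := by
    rw [hgsum S C hC]
    have h1 : c * #C ≤ c * T := by gcongr
    have h2 : c * T = δ := by rw [hc]; field_simp
    have h3 : (3 : ℝ) ≤ #S := by exact_mod_cast hN3.trans hS
    linarith
  -- Each side is weighted by the total mass of the other, so that `f` sums to zero.
  set α := ∑ v ∈ Sᶜ, g B' v with hα
  set β := ∑ v ∈ S, g B v with hβ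
  have hα0 : 0 < α := hgpos _ _ hS' hBS' hBT'
  have hβ0 : 0 < β := hgpos _ _ hS hBS hBT
  set f : V → ℝ := fun v => if v ∈ S then α * g B v else -β * g B' v with hf
  have hfS : ∀ v ∈ S, f v = α * g B v := fun v hv => by simp [hf, hv]
  have hfS' : ∀ v ∈ Sᶜ, f v = -β * g B' v := fun v hv => by simp [hf, mem_compl.1 hv]
  have hfsum : ∑ v, f v = 0 := by
    rw [← sum_add_sum_compl S, sum_congr rfl hfS, sum_congr rfl hfS', ← mul_sum, ← mul_sum]
    ring
  have hfsq : ∑ v, f v ^ 2 = α ^ 2 * (#S - #B + #B * (1 - c) ^ 2) +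
      β ^ 2 * (#Sᶜ - #B' + #B' * (1 - c) ^ 2) := by
    rw [← sum_add_sum_compl S, sum_congr rfl fun v hv => by rw [hfS v hv],
      sum_congr (s₁ := Sᶜ) rfl fun v hv => by rw [hfS' v hv]]
    simp only [mul_pow, ← mul_sum, hgsq _ _ hBS, hgsq _ _ hBS', neg_sq]
  have hf0 : f ≠ 0 := by
    intro h0
    have : ∑ v ∈ S, f v = 0 := by simp [h0]
    rw [sum_congr rfl hfS, ← mul_sum] at this
    exact (mul_pos hα0 hβ0).ne' this
  refine hG.le_secondEigenvalue hδ.le hf0 hfsum ?_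
  have hin (S C : Finset V) (hC : C ⊆ S) (γ : ℝ) :
      ∑ i ∈ S, ∑ j ∈ S, (if G.Adj i j then (γ * g C i - γ * g C j) ^ 2 else 0) ≤
        2 * γ ^ 2 * c ^ 2 * (#C * (#S - #C)) := by
    -- The bracket indicates that exactly one of `i`, `j` lies in `C`; all such pairs are charged,
    -- adjacent or not.
    have hle : ∀ i j, (if G.Adj i j then (γ * g C i - γ * g C j) ^ 2 else 0) ≤
        γ ^ 2 * c ^ 2 * ((if i ∈ C then 1 else 0) + (if j ∈ C then 1 else 0) -
          2 * (if i ∈ C then 1 else 0) * (if j ∈ C then 1 else 0)) := by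
      intro i j
      have : 0 ≤ γ ^ 2 * c ^ 2 := by positivity
      simp only [hg]
      split_ifs <;> nlinarith
    refine (sum_le_sum fun i _ => sum_le_sum fun j _ => hle i j).trans (le_of_eq ?_)
    simp only [← mul_sum, sum_add_distrib, sum_sub_distrib, sum_ite_mem, inter_eq_right.2 hC,
      ← sum_mul]
    simp [inter_eq_right.2 hC]
    ring
  have hcross : ∑ i ∈ S, ∑ j ∈ Sᶜ, (if G.Adj i j then (f i - f j) ^ 2 else 0) ≤
      T * ((α + β) ^ 2 * (1 - c) ^ 2) := by
    rw [← sum_product', ← sum_filter]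
    refine (sum_le_card_nsmul _ _ ((α + β) ^ 2 * (1 - c) ^ 2) ?_).trans ?_
    · rintro ⟨i, j⟩ hij
      simp only [mem_filter, mem_product] at hij
      obtain ⟨⟨hi, hj⟩, hij⟩ := hij
      have hiB : i ∈ B := hB i hi j hj hij
      have hjB : j ∈ B' := hB' i hi j hj hij
      simp only [hfS i hi, hfS' j hj, hg, hiB, hjB, if_true]
      exact le_of_eq (by ring)
    · rw [nsmul_eq_mul]
      gcongr
      exact hcut
  have hswap : ∑ i ∈ Sᶜ, ∑ j ∈ S, (if G.Adj i j then (f i - f j) ^ 2 else 0) =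
      ∑ i ∈ S, ∑ j ∈ Sᶜ, (if G.Adj i j then (f i - f j) ^ 2 else 0) := by
    rw [sum_comm]
    refine sum_congr rfl fun i _ => sum_congr rfl fun j _ => ?_
    simp only [G.adj_comm i j]
    split_ifs <;> ring
  have hSS : ∑ i ∈ S, ∑ j ∈ S, (if G.Adj i j then (f i - f j) ^ 2 else 0) ≤
      2 * α ^ 2 * c ^ 2 * (#B * (#S - #B)) := by
    refine le_of_eq_of_le (sum_congr rfl fun i hi => sum_congr rfl fun j hj => ?_) (hin S B hBS α)
    rw [hfS i hi, hfS j hj]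
  have hSS' : ∑ i ∈ Sᶜ, ∑ j ∈ Sᶜ, (if G.Adj i j then (f i - f j) ^ 2 else 0) ≤
      2 * β ^ 2 * c ^ 2 * (#B' * (#Sᶜ - #B')) := by
    rw [← neg_sq β]
    refine le_of_eq_of_le (sum_congr rfl fun i hi => sum_congr rfl fun j hj => ?_)
      (hin Sᶜ B' hBS' (-β))
    rw [hfS' i hi, hfS' j hj]
  have hsplit : (∑ i, ∑ j, if G.Adj i j then (f i - f j) ^ 2 else 0) =
      (∑ i ∈ S, ∑ j ∈ S, (if G.Adj i j then (f i - f j) ^ 2 else 0) +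
        ∑ i ∈ S, ∑ j ∈ Sᶜ, (if G.Adj i j then (f i - f j) ^ 2 else 0)) +
      (∑ i ∈ Sᶜ, ∑ j ∈ S, (if G.Adj i j then (f i - f j) ^ 2 else 0) +
        ∑ i ∈ Sᶜ, ∑ j ∈ Sᶜ, (if G.Adj i j then (f i - f j) ^ 2 else 0)) := by
    simp only [← sum_add_distrib, sum_add_sum_compl]
  rw [hsplit, hswap, hfsq]
  have h1 := mul_le_mul_of_nonneg_left (hside hS hBT) (sq_nonneg α)
  have h2 := mul_le_mul_of_nonneg_left (hside hS' hBT') (sq_nonneg β)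
  have h3 : (T : ℝ) * ((α + β) ^ 2 * (1 - c) ^ 2) ≤
      T * ((2 * α ^ 2 + 2 * β ^ 2) * (1 - c) ^ 2) := by
    gcongr
    linarith only [add_sq_le (a := α) (b := β)]
  linarith only [h1, h2, h3, hSS, hSS', hcross]

/-! ### Small cuts in regular graphs and edge-connectivity. -/

theorem IsRegularOfDegree.card_interedges_add_card_interedges_compl {d : ℕ}
    (hG : G.IsRegularOfDegree d) (S : Finset V) :
    #(G.interedges S S) + #(G.interedges S Sᶜ) = #S * d := by
  rw [card_interedges_eq_sum, card_interedges_eq_sum, ← sum_add_distrib, ← smul_eq_mul,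
    ← sum_const]
  refine sum_congr rfl fun v _ => ?_
  rw [← hG.degree_eq v, ← card_neighborFinset_eq_degree, neighborFinset_eq_filter, card_filter,
    card_filter, card_filter, sum_add_sum_compl]

/-- In a regular graph of degree `d`, a nonempty set left by fewer than `d` edges has more than
`d` vertices. -/
theorem IsRegularOfDegree.lt_card_of_card_interedges_lt {d : ℕ} (hG : G.IsRegularOfDegree d)
    {S : Finset V} (hS : S.Nonempty) (hcut : #(G.interedges S Sᶜ) < d) : d < #S := by
  have h1 := hG.card_interedges_add_card_interedges_compl S
  have h2 := card_interedges_self_le G S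
  by_contra! hle
  obtain ⟨m, hm⟩ : ∃ m, #S = m + 1 := ⟨#S - 1, by have := hS.card_pos; omega⟩
  rw [hm] at h1 h2 hle
  rw [Nat.add_sub_cancel] at h2
  -- With `m + 1 ≤ d` vertices the cut has at least `(m + 1) * (d - m) = d + m * (d - m - 1)` edges.
  nlinarith

theorem exists_cut_of_not_isEdgeConnected {k : ℕ} (h : ¬ G.IsEdgeConnected (k + 1)) :
    ∃ S : Finset V, S.Nonempty ∧ Sᶜ.Nonempty ∧ #(G.interedges S Sᶜ) ≤ k := by
  classical
  simp only [IsEdgeConnected, IsEdgeReachable, not_forall] at h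
  obtain ⟨u, v, s, hs, huv⟩ := h
  refine ⟨univ.filter ((G.deleteEdges s).Reachable u), ⟨u, by simp⟩, ⟨v, by simpa using huv⟩, ?_⟩
  -- Every edge leaving the component of `u` must have been deleted.
  set S := univ.filter ((G.deleteEdges s).Reachable u) with hS
  have hcut : ∀ p ∈ G.interedges S Sᶜ, s(p.1, p.2) ∈ s := by
    intro p hp
    obtain ⟨h1, h2, h3⟩ := G.mem_interedges_iff.1 hp
    by_contra hps
    simp only [hS, mem_filter, mem_univ, true_and, mem_compl] at h1 h2
    exact h2 (h1.trans (Adj.reachable (deleteEdges_adj.2 ⟨h3, hps⟩)))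
  have hinj : Set.InjOn (fun p : V × V => s(p.1, p.2)) (G.interedges S Sᶜ : Set (V × V)) := by
    rintro ⟨a, b⟩ hp ⟨a', b'⟩ hq hpq
    obtain ⟨h1, h2, -⟩ := G.mem_interedges_iff.1 hp
    obtain ⟨h1', h2', -⟩ := G.mem_interedges_iff.1 hq
    rcases Sym2.eq_iff.1 hpq with ⟨rfl, rfl⟩ | ⟨rfl, rfl⟩
    · rfl
    · exact absurd h1 (mem_compl.1 h2')
  have hle : ((G.interedges S Sᶜ : Set (V × V))).encard ≤ s.encard := by
    rw [← hinj.encard_image]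
    exact Set.encard_le_encard (Set.image_subset_iff.2 hcut)
  rw [Set.encard_coe_eq_coe_finsetCard] at hle
  have := hle.trans_lt hs
  exact Nat.lt_succ_iff.1 (by exact_mod_cast this)

theorem le_edgeConnectivity_of_forall_cut {k : ℕ}
    (h : ∀ S : Finset V, S.Nonempty → Sᶜ.Nonempty → k < #(G.interedges S Sᶜ)) :
    ((k + 1 : ℕ) : ℕ∞) ≤ G.edgeConnectivity := by
  refine le_sSup ⟨k + 1, rfl, ?_⟩
  by_contra hc
  obtain ⟨S, hS, hS', hle⟩ := exists_cut_of_not_isEdgeConnected hc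
  exact (h S hS hS').not_ge hle

theorem card_interedges_compl_comm (S : Finset V) :
    #(G.interedges Sᶜ S) = #(G.interedges S Sᶜ) :=
  haveI : Std.Symm G.Adj := G.symm
  Rel.card_interedges_comm _ _

end SimpleGraph

/-! ### The thresholds and the main theorem. -/

/-- The smaller root `δ` of `δ * (m - δ) = 2 * t`. -/
theorem exists_root_of_two_mul_le {m t : ℝ} (ht : 0 < t) (htm : t + 2 ≤ m) :
    ∃ δ : ℝ, 0 < δ ∧ δ ≤ 2 ∧ δ * (m - δ) = 2 * t ∧ √(m ^ 2 - 8 * t) = m - 2 * δ := by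
  have hnn : 0 ≤ m ^ 2 - 8 * t := by nlinarith [sq_nonneg (m - 4)]
  refine ⟨(m - √(m ^ 2 - 8 * t)) / 2, ?_, ?_, ?_, by ring⟩
  · have : √(m ^ 2 - 8 * t) < m := (Real.sqrt_lt' (by linarith)).2 (by linarith)
    linarith
  -- Squared, this is exactly `t + 2 ≤ m`.
  · have : m - 4 ≤ √(m ^ 2 - 8 * t) := Real.le_sqrt_of_sq_le (by nlinarith)
    linarith
  · have := Real.sq_sqrt hnn
    linarith

theorem theorem3p3 {V : Type*} [Fintype V] [DecidableEq V] [Nontrivial V]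
    (G : SimpleGraph V) [DecidableRel G.Adj] (d t : ℕ) (ht : 3 ≤ t) (htd : t ≤ d - 1)
    (hG : G.IsRegularOfDegree d) :
    (G.secondEigenvalue < ((d : ℝ) - 3 + Real.sqrt (((d : ℝ) + 3) ^ 2 - 8 * (t : ℝ))) / 2 →
      ((t + 1 : ℕ) : ℕ∞) ≤ G.edgeConnectivity) ∧
    (Odd t →
      G.secondEigenvalue < ((d : ℝ) - 4 + Real.sqrt (((d : ℝ) + 4) ^ 2 - 8 * (t : ℝ))) / 2 →
      ((t + 1 : ℕ) : ℕ∞) ≤ G.edgeConnectivity) := by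
  have htd' : t + 1 ≤ d := by omega
  have ht3 : (3 : ℝ) ≤ t := by exact_mod_cast ht
  have htdR : (t : ℝ) + 1 ≤ d := by exact_mod_cast htd'
  have hsides (S : Finset V) (hS : S.Nonempty) (hcut : (G.interedges S Sᶜ).card ≤ t) :
      d + 1 ≤ S.card := hG.lt_card_of_card_interedges_lt hS (by omega)
  have hsides' (S : Finset V) (hS : Sᶜ.Nonempty) (hcut : (G.interedges S Sᶜ).card ≤ t) :
      d + 1 ≤ Sᶜ.card :=
    hsides _ hS (by rwa [compl_compl, SimpleGraph.card_interedges_compl_comm])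
  refine ⟨fun hlt => ?_, fun hodd hlt => ?_⟩
  · obtain ⟨δ, hδ, hδ2, hroot, hsqrt⟩ :=
      exists_root_of_two_mul_le (m := d + 3) (t := t) (by linarith) (by linarith)
    rw [hsqrt] at hlt
    refine SimpleGraph.le_edgeConnectivity_of_forall_cut fun S hS hS' => ?_
    by_contra! hcut
    have := hG.le_secondEigenvalue_of_cut S (N := d + 1) (T := t) hδ hδ2 (by omega) (by omega)
      (by push_cast; linarith) (hsides S hS hcut) (hsides' S hS' hcut) hcut
    linarith
  · obtain ⟨δ, hδ, hδ2, hroot, hsqrt⟩ :=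
      exists_root_of_two_mul_le (m := d + 4) (t := t) (by linarith) (by linarith)
    rw [hsqrt] at hlt
    refine SimpleGraph.le_edgeConnectivity_of_forall_cut fun S hS hS' => ?_
    by_contra! hcut
    suffices d - δ ≤ G.secondEigenvalue by linarith
    have h1 := hsides S hS hcut
    have h2 := hsides' S hS' hcut
    rcases hcut.lt_or_eq with hlt | heq
    · obtain ⟨r, rfl⟩ : ∃ r, t = r + 1 := ⟨t - 1, by omega⟩
      push_cast at hroot
      -- Here `δ * (d + 3 - δ) = 2 * t - δ ≥ 2 * (t - 1)` since `δ ≤ 2`.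
      exact hG.le_secondEigenvalue_of_cut S (N := d + 1) (T := r) hδ hδ2 (by omega) (by omega)
        (by push_cast; linarith) h1 h2 (by omega)
    · have hne (R : Finset V) (hR : (G.interedges R Rᶜ).card = t) : R.card ≠ d + 1 := by
        intro hc
        have hsum := hG.card_interedges_add_card_interedges_compl R
        rw [hR, hc] at hsum
        -- The degree sum of `R` is even, as is its inner part, so the cut would be even, against
        -- `t` odd.
        have heven : Even ((d + 1) * d) := by simpa [mul_comm] using Nat.even_mul_succ_self d
        rw [← hsum, Nat.even_add] at heven
        exact (Nat.not_even_iff_odd.2 hodd) (heven.1 (SimpleGraph.even_card_interedges_self G R))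
      have h3 := hne S heq
      have h4 := hne Sᶜ (by rwa [compl_compl, SimpleGraph.card_interedges_compl_comm])
      exact hG.le_secondEigenvalue_of_cut S (N := d + 2) (T := t) hδ hδ2 (by omega) (by omega)
        (by push_cast; linarith) (by omega) (by omega) hcut
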